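/- All logarithms are to base $2$. For a finite set $S$ of integers greater than one let $w(S)=\sum_{s\in S}\frac{1}{\log s}$. For a red-blue coloring $c$ of the edges of the complete graph on $\{2,\ldots,n\}$ let $f(c)$ be the maximum of $w(S)$ over all sets $S\subseteq\{2,\ldots,n\}$ that form a monochromatic clique in $c$, and let $f(n)$ be the minimum of $f(c)$ over all such colorings $c$. Theorem. For all sufficiently large $n$, every red-blue coloring of the edges of the complete graph on $\{2,\ldots,n\}$ contains a monochromatic clique with vertex set $S$ such that $$\sum_{s\in S}\frac{1}{\log s}\ \ge\ 2^{-8}\log\log\log n.$$ Moreover, $f(n)=\Theta(\log\log\log n)$ as $n\to\infty$; that is, there are constants $C\ge c>0$ such that $c\log\log\log n\le f(n)\le C\log\log\log n$ for all sufficiently large $n$. -/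

import Mathlib

open Filter Asymptotics

noncomputable section

/-- The weight `w(S) = ∑_{s ∈ S} 1 / log₂ s` of a finite set of integers greater than one. -/
def weight (S : Finset ℕ) : ℝ := ∑ s ∈ S, 1 / Real.logb 2 (s : ℝ)

/-- Red-blue colorings of the edges of the complete graph on the vertex set `{2, …, n}`
(the two colors are the elements of `Bool`; adjacent edges may have the same color). -/
abbrev EdgeColoring (n : ℕ) : Type := SimpleGraph.TopEdgeLabeling (Finset.Icc 2 n) Bool

/-- The set `S ⊆ {2, …, n}` is the vertex set of a monochromatic clique in the coloring `c`:
for one of the two colors, all edges between distinct vertices of `S` have that color. -/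
def IsMonoClique {n : ℕ} (c : EdgeColoring n) (S : Finset ℕ) : Prop :=
  S ⊆ Finset.Icc 2 n ∧
    ∃ k : Bool, (c.labelGraph k).IsClique {v : Finset.Icc 2 n | (v : ℕ) ∈ S}

/-- `f(c)`: the maximum weight of a monochromatic clique in the coloring `c`. -/
def maxWeight {n : ℕ} (c : EdgeColoring n) : ℝ :=
  sSup {x : ℝ | ∃ S : Finset ℕ, IsMonoClique c S ∧ weight S = x}

/-- `f(n)`: the minimum of `f(c)` over all red-blue edge-colorings of the complete graph
on `{2, …, n}`. -/
def minMaxWeight (n : ℕ) : ℝ := sInf {x : ℝ | ∃ c : EdgeColoring n, maxWeight c = x}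

/-- The supremum defining `f(c)` is attained. -/
theorem maxWeight_isGreatest {n : ℕ} (c : EdgeColoring n) :
    IsGreatest {x : ℝ | ∃ S : Finset ℕ, IsMonoClique c S ∧ weight S = x} (maxWeight c) := by
  have hfin : {x : ℝ | ∃ S : Finset ℕ, IsMonoClique c S ∧ weight S = x}.Finite := by
    refine ((Finset.Icc 2 n).powerset.finite_toSet.image weight).subset ?_
    rintro x ⟨S, hS, rfl⟩
    exact ⟨S, Finset.mem_coe.2 (Finset.mem_powerset.2 hS.1), rfl⟩
  have hne : {x : ℝ | ∃ S : Finset ℕ, IsMonoClique c S ∧ weight S = x}.Nonempty :=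
    ⟨_, ∅, ⟨by simp, true, by simp⟩, rfl⟩
  exact ⟨hne.csSup_mem hfin, fun _ hx => le_csSup hfin.bddAbove hx⟩

/-- The infimum defining `f(n)` is attained. -/
theorem minMaxWeight_isLeast (n : ℕ) :
    IsLeast {x : ℝ | ∃ c : EdgeColoring n, maxWeight c = x} (minMaxWeight n) := by
  have hfin : {x : ℝ | ∃ c : EdgeColoring n, maxWeight c = x}.Finite :=
    Set.finite_range (fun c : EdgeColoring n => maxWeight c)
  have hne : {x : ℝ | ∃ c : EdgeColoring n, maxWeight c = x}.Nonempty :=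
    ⟨_, (fun _ => true : EdgeColoring n), rfl⟩
  exact ⟨hne.csInf_mem hfin, fun _ hx => csInf_le hfin.bddBelow hx⟩

end

/-!
Lower bound. Among the vertices up to `n` take disjoint blocks `I j`, `j < m`, of about `2 ^ L j`
vertices of weight at least `1 / L j` each, where `L j` grows geometrically with a ratio exponential in
`m`, so that `m` is about `√(log log n)`. The blocks are treated as vertices of a complete graph.
Dependent random choice (`exists_subset_large_common_neighborhoods`) shrinks the lowest block `i`
slightly, and gives it one color `χ j` towards each higher block `j`, such that every subset of the
shrunken block of moderate size has a large common `χ j`-neighborhood in block `j`. Take a largest red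
clique `R` and a largest blue clique `B` in the shrunken block, and restrict every higher block to the
common neighborhood of `R ∪ B`: now block `j` sees all of `R ∪ B` in color `χ j`. If `χ j` is red for
`x` of the higher blocks and blue for `y` of them, then `R` extends every red clique found in the
former, and `B` every blue clique found in the latter.

Let `r` and `b` be the weights `|R| / L i` and `|B| / L i`. They cannot both be small: the biased Ramsey
bound `card_mul_pow_le_one` implies that `b` is at least exponential in `1 / r` when `r` is small, and
symmetrically. In particular `exp (-16 r) + exp (-16 b) ≤ 1` (`exp_neg_add_exp_neg_le_one`). This
is precisely what an induction in the style of Erdős and Szekeres needs in order to show that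
`m + 1 ≤ exp (16 (ρ + β))`, where `ρ` and `β` bound the weights of red and blue cliques
(`card_blocks_le_exp`). Hence some monochromatic clique has weight of order `log m`, that is, of order
`log log log n`, and the constants leave room for the factor `2 ^ (-8)`.

Upper bound. Cut `{2, …, n}` into the blocks `2 ^ 2 ^ i ≤ s < 2 ^ 2 ^ (i + 1)`, and color the edges inside
each block, and the pairs of block indices, without monochromatic cliques of more than logarithmic size
(`exists_coloring_forall_mono_card_le`). A monochromatic clique meets `O(log log log n)` blocks and has
bounded weight in each of them (`exists_coloring_weight_le`).
-/

/-! ### Biased Ramsey bound -/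

/-- `S` is a clique all of whose edges have color `k` under `col`; only values of `col` at pairs of
distinct vertices matter. -/
def MonoOn {V : Type*} (col : V → V → Bool) (k : Bool) (S : Finset V) : Prop :=
  ∀ u ∈ S, ∀ v ∈ S, u ≠ v → col u v = k

section Ramsey

variable {V : Type*} {col : V → V → Bool}

theorem MonoOn.empty (k : Bool) : MonoOn col k ∅ := by simp [MonoOn]

variable [DecidableEq V]

theorem MonoOn.union (hs : ∀ u v, col u v = col v u) {k : Bool} {S T : Finset V}
    (hS : MonoOn col k S) (hT : MonoOn col k T) (hST : ∀ u ∈ S, ∀ v ∈ T, col u v = k) :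
    MonoOn col k (S ∪ T) := by
  intro u hu v hv huv
  rcases Finset.mem_union.1 hu with hu | hu <;> rcases Finset.mem_union.1 hv with hv | hv
  · exact hS u hu v hv huv
  · exact hST u hu v hv
  · rw [hs]; exact hST v hv u hu
  · exact hT u hu v hv huv

/-- Ramsey's theorem with an arbitrary bias `p`: every vertex is charged a factor `p` on the red side
and `1 - p` on the blue side, and these add up to one when `A` is split into the red and the blue
neighborhood of a vertex. -/
theorem card_mul_pow_le_one (hs : ∀ u v, col u v = col v u) {p : ℝ} (hp0 : 0 < p) (hp1 : p < 1)
    (A : Finset V) (a b : ℕ) (ha : ∀ S ⊆ A, MonoOn col true S → S.card ≤ a)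
    (hb : ∀ S ⊆ A, MonoOn col false S → S.card ≤ b) :
    ((A.card : ℝ) + 1) * (p ^ a * (1 - p) ^ b) ≤ 1 := by
  induction A using Finset.strongInduction generalizing a b with
  | H A ih =>
  have hp1' : 0 < 1 - p := by linarith
  rcases A.eq_empty_or_nonempty with rfl | ⟨v, hv⟩
  · simpa using mul_le_one₀ (pow_le_one₀ hp0.le hp1.le) (by positivity)
      (pow_le_one₀ hp1'.le (by linarith))
  have hext : ∀ k, ∀ S ⊆ (A.erase v).filter (fun u => col v u = k), MonoOn col k S →
      insert v S ⊆ A ∧ MonoOn col k (insert v S) ∧ (insert v S).card = S.card + 1 := by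
    intro k S hS hmono
    have hvS : v ∉ S := fun h => by simpa using hS h
    refine ⟨?_, ?_, Finset.card_insert_of_notMem hvS⟩
    · intro u hu
      rcases Finset.mem_insert.1 hu with rfl | hu
      · exact hv
      · exact (Finset.mem_erase.1 (Finset.mem_filter.1 (hS hu)).1).2
    · rw [Finset.insert_eq]
      refine MonoOn.union hs (by simp [MonoOn]) hmono ?_
      intro u hu w hw
      rw [Finset.mem_singleton.1 hu]
      exact (Finset.mem_filter.1 (hS hw)).2
  have hsub : ∀ k, (A.erase v).filter (fun u => col v u = k) ⊂ A := fun k =>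
    (Finset.filter_subset _ _).trans_ssubset (Finset.erase_ssubset hv)
  have hcard : A.card + 1 = (((A.erase v).filter (fun u => col v u = true)).card + 1) +
      (((A.erase v).filter (fun u => col v u = false)).card + 1) := by
    have h1 := Finset.card_filter_add_card_filter_not (s := A.erase v) (fun u => col v u = true)
    have h2 := Finset.card_erase_add_one hv
    simp only [Bool.not_eq_true] at h1
    omega
  obtain ⟨a, rfl⟩ : ∃ a', a = a' + 1 := Nat.exists_eq_succ_of_ne_zero (by
    have := ha {v} (by simpa using hv) (by simp [MonoOn])
    rw [Finset.card_singleton] at this; omega)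
  obtain ⟨b, rfl⟩ : ∃ b', b = b' + 1 := Nat.exists_eq_succ_of_ne_zero (by
    have := hb {v} (by simpa using hv) (by simp [MonoOn])
    rw [Finset.card_singleton] at this; omega)
  have hR := ih _ (hsub true) a (b + 1)
    (fun S hS hm => by
      obtain ⟨h1, h2, h3⟩ := hext true S hS hm
      have := ha _ h1 h2
      omega)
    (fun S hS hm => hb S (hS.trans (hsub true).subset) hm)
  have hB := ih _ (hsub false) (a + 1) b
    (fun S hS hm => ha S (hS.trans (hsub false).subset) hm)
    (fun S hS hm => by
      obtain ⟨h1, h2, h3⟩ := hext false S hS hm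
      have := hb _ h1 h2
      omega)
  have hcard' := congrArg (Nat.cast (R := ℝ)) hcard
  push_cast at hcard'
  rw [hcard']
  have hR' := mul_le_mul_of_nonneg_left hR hp0.le
  have hB' := mul_le_mul_of_nonneg_left hB hp1'.le
  calc _ = p * _ + (1 - p) * _ := by ring
    _ ≤ _ := add_le_add hR' hB'
    _ = 1 := by ring

end Ramsey

/-! ### Trade-off between red and blue cliques -/

section Exponents

/-- The case in which `r` is the smaller of the two normalized clique sizes. The bias `1 / 2` bounds `b`
from below; a second bias, depending on `b`, bounds `r` below by a multiple of `1 / log (8 b)`, which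
is far more than the exponentially small amount needed. -/
theorem exp_neg_add_exp_neg_le_one_aux {r b : ℝ} (hr : 0 ≤ r) (hrb : r ≤ b)
    (h : ∀ p : ℝ, 0 < p → p < 1 → 1 / 2 ≤ r * -Real.log p + b * -Real.log (1 - p)) :
    Real.exp (-16 * r) + Real.exp (-16 * b) ≤ 1 := by
  have hlog : ∀ x : ℝ, 0 < x → x < 1 → -Real.log (1 - x) ≤ x / (1 - x) := by
    intro x hx0 hx1
    have := Real.one_sub_inv_le_log_of_pos (show 0 < 1 - x by linarith)
    have h1 : (1 - x)⁻¹ - 1 = x / (1 - x) := by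
      have : 1 - x ≠ 0 := by linarith
      field_simp; ring
    linarith
  have hb : 1 / 3 ≤ b := by
    have h2 := h (1 / 2) (by norm_num) (by norm_num)
    have : Real.log (1 / 2) = -Real.log 2 := by rw [one_div, Real.log_inv]
    rw [show (1 : ℝ) - 1 / 2 = 1 / 2 by norm_num, this] at h2
    have := Real.log_two_lt_d9
    have : 1 / 2 ≤ (2 * b) * Real.log 2 := by
      have := mul_le_mul_of_nonneg_right hrb (Real.log_nonneg one_le_two)
      linarith
    nlinarith
  have hb0 : 0 < b := by linarith
  -- The bias `1 / (8 b)` makes the contribution of the larger side `b` at most `1 / 4`.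
  have hp := h (1 / (8 * b)) (by positivity) (by rw [div_lt_one (by positivity)]; linarith)
  have h1 : b * -Real.log (1 - 1 / (8 * b)) ≤ 1 / 4 := by
    have h2 := hlog (1 / (8 * b)) (by positivity) (by rw [div_lt_one (by positivity)]; linarith)
    refine (mul_le_mul_of_nonneg_left h2 hb0.le).trans ?_
    have h3 : b * (1 / (8 * b) / (1 - 1 / (8 * b))) = b / (8 * b - 1) := by
      have : 8 * b - 1 ≠ 0 := by linarith
      have : 1 - 1 / (8 * b) ≠ 0 := by
        have : 1 - 1 / (8 * b) = (8 * b - 1) / (8 * b) := by field_simp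
        rw [this]; positivity
      field_simp
    rw [h3, div_le_div_iff₀ (by linarith) (by norm_num)]
    linarith
  rw [one_div (8 * b), Real.log_inv, neg_neg, ← one_div] at hp
  have h2 : 1 / 4 ≤ r * Real.log (8 * b) := by linarith
  have h3 : Real.log (8 * b) ≤ 8 * b := by
    have := Real.log_le_sub_one_of_pos (show 0 < 8 * b by positivity)
    linarith
  have h4 : 1 / 4 ≤ r * (8 * b) := h2.trans (mul_le_mul_of_nonneg_left h3 hr)
  have hr0 : 0 < r := by
    rcases hr.eq_or_lt with h | h
    · rw [← h] at h4; norm_num at h4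
    · exact h
  set y := Real.exp (-16 * b) with hy
  have hy0 : 0 < y := Real.exp_pos _
  have hyb : y * (1 + 16 * b) ≤ 1 := by
    have := Real.add_one_le_exp (16 * b)
    calc y * (1 + 16 * b) ≤ y * Real.exp (16 * b) := by gcongr; linarith
      _ = 1 := by rw [hy, ← Real.exp_add]; simp
  have hy2 : y ≤ 1 / 2 := by nlinarith
  have h5 : -Real.log (1 - y) ≤ 16 * r := by
    refine (hlog y hy0 (by linarith)).trans ?_
    rw [div_le_iff₀ (by linarith)]
    have : 2 * y * b ≤ 16 * r * b := by nlinarith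
    have : 2 * y ≤ 16 * r := le_of_mul_le_mul_right this hb0
    nlinarith
  have h6 : Real.exp (-16 * r) ≤ 1 - y := by
    rw [← Real.le_log_iff_exp_le (by linarith)]
    linarith
  linarith

/-- The trade-off between the largest red and blue cliques in a set of at least `exp (L / 2)` vertices. If the
clique sizes `a` and `b` satisfy the conclusion of `card_mul_pow_le_one` for every bias `p`, then the
normalized sizes `a / L` and `b / L` can themselves be charged in the same splitting argument, with
factors `exp (-16 a / L)` and `exp (-16 b / L)`. -/
theorem exp_neg_add_exp_neg_le_one {L : ℝ} (hL : 0 < L) (a b : ℕ)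
    (h : ∀ p : ℝ, 0 < p → p < 1 → Real.exp (1 / 2 * L) * (p ^ a * (1 - p) ^ b) ≤ 1) :
    Real.exp (-16 * (a / L)) + Real.exp (-16 * (b / L)) ≤ 1 := by
  have key : ∀ p : ℝ, 0 < p → p < 1 →
      1 / 2 ≤ a / L * -Real.log p + b / L * -Real.log (1 - p) := by
    intro p hp0 hp1
    have hp1' : 0 < 1 - p := by linarith
    have h1 := Real.log_nonpos (by positivity) (h p hp0 hp1)
    rw [Real.log_mul (by positivity) (by positivity), Real.log_mul (by positivity) (by positivity),
      Real.log_exp, Real.log_pow, Real.log_pow] at h1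
    have : a / L * -Real.log p + b / L * -Real.log (1 - p) =
      (-(a * Real.log p + b * Real.log (1 - p))) / L := by field_simp; ring
    rw [this, le_div_iff₀ hL]
    linarith
  rcases le_total (a / L) (b / L) with hab | hab
  · exact exp_neg_add_exp_neg_le_one_aux (by positivity) hab key
  · rw [add_comm]
    refine exp_neg_add_exp_neg_le_one_aux (by positivity) hab fun p hp0 hp1 => ?_
    have := key (1 - p) (by linarith) (by linarith)
    rw [sub_sub_cancel] at this
    linarith

end Exponents

/-! ### Dependent random choice -/

section RandomChoice

variable {V : Type*} {col : V → V → Bool}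

theorem exists_forall_mem_iff_exists_eq {U : Finset V} (hU : U.Nonempty) {k : ℕ}
    (hk : U.card ≤ k) : ∃ u : Fin k → V, ∀ x, x ∈ U ↔ ∃ i, u i = x := by
  obtain ⟨x₀, hx₀⟩ := hU
  refine ⟨fun i => if h : (i : ℕ) < U.card then (U.equivFin.symm ⟨i, h⟩ : V) else x₀, fun x => ?_⟩
  constructor
  · intro hx
    refine ⟨⟨U.equivFin ⟨x, hx⟩, (U.equivFin ⟨x, hx⟩).2.trans_le hk⟩, ?_⟩
    simp
  · rintro ⟨i, rfl⟩
    dsimp only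
    split_ifs
    · exact Finset.coe_mem _
    · exact hx₀

/-- Dependent random choice between two vertex classes. Half of `A` agrees on a majority color `χ`
towards `B`, and the common `χ`-neighborhood in `A` of `q` random vertices of `B` is still large, while
it is unlikely to contain few vertices with a small common neighborhood in `B`. -/
theorem exists_subset_large_common_neighborhood [DecidableEq V] {A B : Finset V} {q Q : ℕ} (k : ℕ)
    (hq : 1 ≤ q) (hA : A.card ≤ 2 ^ (q * Q)) (hB : B.Nonempty) :
    ∃ χ : Bool, ∃ A' ⊆ A, A.card ≤ 2 ^ (q + 2) * A'.card ∧ ∀ U ⊆ A', U.card ≤ k →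
      B.card ≤ 2 ^ (2 + k * Q) * (B.filter fun b => ∀ u ∈ U, col u b = χ).card := by
  obtain ⟨χ, hχ⟩ : ∃ χ : Bool, A.card ≤
      2 * (A.filter fun x => B.card ≤ 2 * (B.filter fun b => col x b = χ).card).card := by
    by_contra! hcon
    have h1 : A ⊆ (A.filter fun x => B.card ≤ 2 * (B.filter fun b => col x b = true).card) ∪
        (A.filter fun x => B.card ≤ 2 * (B.filter fun b => col x b = false).card) := by
      intro x hx
      have h2 := Finset.card_filter_add_card_filter_not (s := B) (fun b => col x b = true)
      simp only [Bool.not_eq_true] at h2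
      simp only [Finset.mem_union, Finset.mem_filter, hx, true_and]
      omega
    have h2 := (Finset.card_le_card h1).trans (Finset.card_union_le _ _)
    have h3 := hcon true
    have h4 := hcon false
    omega
  set A₀ := A.filter fun x => B.card ≤ 2 * (B.filter fun b => col x b = χ).card with hA₀
  have hA₀A : A₀ ⊆ A := Finset.filter_subset _ _
  rcases A₀.eq_empty_or_nonempty with h0 | hA₀ne
  · rw [h0] at hχ
    refine ⟨χ, ∅, Finset.empty_subset _, by simpa using hχ, fun U hU _ => ?_⟩
    rw [Finset.subset_empty.1 hU]
    simpa using Nat.le_mul_of_pos_left B.card (by positivity : 0 < 2 ^ (2 + k * Q))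
  set P : Finset (Fin q → V) := Fintype.piFinset fun _ => B with hP
  have hPcard : P.card = B.card ^ q := by simp [hP]
  have hPpos : 0 < P.card := by rw [hPcard]; exact pow_pos hB.card_pos _
  let K : Finset (Fin k → V) := (Fintype.piFinset fun _ => A₀).filter fun u =>
    2 ^ (2 + k * Q) * (B.filter fun b => ∀ i, col (u i) b = χ).card < B.card
  suffices h : ∃ T ∈ P, A₀.card ≤ 2 ^ (q + 1) * (A₀.filter fun x => ∀ t, col x (T t) = χ).card ∧
      ∀ u ∈ K, ¬ ∀ t i, col (u i) (T t) = χ by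
    obtain ⟨T, -, hT, hK⟩ := h
    refine ⟨χ, A₀.filter fun x => ∀ t, col x (T t) = χ, (Finset.filter_subset _ _).trans hA₀A,
      ?_, ?_⟩
    · calc A.card ≤ 2 * A₀.card := hχ
        _ ≤ 2 * (2 ^ (q + 1) * _) := Nat.mul_le_mul_left _ hT
        _ = _ := by ring
    · intro U hU hUk
      rcases U.eq_empty_or_nonempty with rfl | hne
      · simpa using Nat.le_mul_of_pos_left B.card (by positivity : 0 < 2 ^ (2 + k * Q))
      · obtain ⟨u, hu⟩ := exists_forall_mem_iff_exists_eq hne hUk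
        have hmem : ∀ i, u i ∈ A₀ ∧ ∀ t, col (u i) (T t) = χ := fun i =>
          Finset.mem_filter.1 (hU ((hu _).2 ⟨i, rfl⟩))
        by_contra! hlt
        refine hK u (Finset.mem_filter.2 ⟨Fintype.mem_piFinset.2 fun i => (hmem i).1, ?_⟩)
          fun t i => (hmem i).2 t
        have hiff : ∀ b, (∀ i, col (u i) b = χ) ↔ ∀ x ∈ U, col x b = χ := fun b => by
          simp [hu]
        simpa only [hiff] using hlt
  by_contra! hcon
  have hsum1 : ∑ T ∈ P, (A₀.filter fun x => ∀ t, col x (T t) = χ).card =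
      ∑ x ∈ A₀, (B.filter fun b => col x b = χ).card ^ q := by
    have := Finset.sum_card_bipartiteAbove_eq_sum_card_bipartiteBelow (s := P) (t := A₀)
      (fun T x => ∀ t, col x (T t) = χ)
    simp only [Finset.bipartiteAbove, Finset.bipartiteBelow] at this
    rw [this]
    refine Finset.sum_congr rfl fun x _ => ?_
    have h1 : (P.filter fun T => ∀ t, col x (T t) = χ) =
        Fintype.piFinset fun _ => B.filter fun b => col x b = χ := by
      ext T; simp [hP, forall_and]
    rw [h1]; simp
  have hsum2 : ∑ T ∈ P, (K.filter fun u => ∀ t i, col (u i) (T t) = χ).card =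
      ∑ u ∈ K, (B.filter fun b => ∀ i, col (u i) b = χ).card ^ q := by
    have := Finset.sum_card_bipartiteAbove_eq_sum_card_bipartiteBelow (s := P) (t := K)
      (fun T u => ∀ t i, col (u i) (T t) = χ)
    simp only [Finset.bipartiteAbove, Finset.bipartiteBelow] at this
    rw [this]
    refine Finset.sum_congr rfl fun u _ => ?_
    have h1 : (P.filter fun T => ∀ t i, col (u i) (T t) = χ) =
        Fintype.piFinset fun _ => B.filter fun b => ∀ i, col (u i) b = χ := by
      ext T; simp [hP, forall_and]
    rw [h1]; simp
  have hmany : A₀.card * P.card ≤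
      2 ^ q * ∑ T ∈ P, (A₀.filter fun x => ∀ t, col x (T t) = χ).card := by
    rw [hsum1, hPcard, Finset.mul_sum, ← smul_eq_mul]
    refine Finset.card_nsmul_le_sum _ _ _ fun x hx => ?_
    rw [← mul_pow]
    exact Nat.pow_le_pow_left (Finset.mem_filter.1 hx).2 _
  have hfew : 2 ^ (q + 1) * ∑ T ∈ P, (K.filter fun u => ∀ t i, col (u i) (T t) = χ).card
      ≤ P.card := by
    have hKcard : K.card ≤ 2 ^ (q * Q * k) := by
      calc K.card ≤ (Fintype.piFinset fun _ : Fin k => A₀).card :=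
            Finset.card_le_card (Finset.filter_subset _ _)
        _ = A₀.card ^ k := by simp
        _ ≤ (2 ^ (q * Q)) ^ k := Nat.pow_le_pow_left ((Finset.card_le_card hA₀A).trans hA) _
        _ = _ := by rw [← pow_mul]
    have h1 : 2 ^ ((2 + k * Q) * q) * ∑ u ∈ K, (B.filter fun b => ∀ i, col (u i) b = χ).card ^ q
        ≤ 2 ^ (q * Q * k) * P.card := by
      refine le_trans ?_ (Nat.mul_le_mul_right _ hKcard)
      rw [Finset.mul_sum, ← smul_eq_mul (a := K.card)]
      refine Finset.sum_le_card_nsmul _ _ _ fun u hu => ?_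
      rw [pow_mul, ← mul_pow, hPcard]
      exact Nat.pow_le_pow_left (Finset.mem_filter.1 hu).2.le _
    rw [hsum2]
    have h2 : (2 + k * Q) * q = q * Q * k + 2 * q := by ring
    rw [h2, pow_add, mul_assoc] at h1
    refine le_trans ?_ (Nat.le_of_mul_le_mul_left h1 (by positivity))
    exact Nat.mul_le_mul_right _ (Nat.pow_le_pow_right (by norm_num) (by omega))
  have hpoint : ∀ T ∈ P,
      2 ^ (q + 1) * (A₀.filter fun x => ∀ t, col x (T t) = χ).card + 1 ≤
      A₀.card + A₀.card * (2 ^ (q + 1) * (K.filter fun u => ∀ t i, col (u i) (T t) = χ).card) := by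
    intro T hT
    by_cases h : A₀.card ≤ 2 ^ (q + 1) * (A₀.filter fun x => ∀ t, col x (T t) = χ).card
    · obtain ⟨u, hu, huT⟩ := hcon T hT h
      have h1 : 1 ≤ (K.filter fun u => ∀ t i, col (u i) (T t) = χ).card :=
        Finset.card_pos.2 ⟨u, Finset.mem_filter.2 ⟨hu, huT⟩⟩
      have h2 : (A₀.filter fun x => ∀ t, col x (T t) = χ).card ≤ A₀.card :=
        Finset.card_le_card (Finset.filter_subset _ _)
      have h3 : 1 ≤ A₀.card := hA₀ne.card_pos
      calc _ ≤ 2 ^ (q + 1) * A₀.card + A₀.card := by gcongr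
        _ = A₀.card + A₀.card * (2 ^ (q + 1) * 1) := by ring
        _ ≤ _ := by gcongr
    · omega
  have htotal := Finset.sum_le_sum hpoint
  rw [Finset.sum_add_distrib, Finset.sum_add_distrib, ← Finset.mul_sum, ← Finset.mul_sum,
    ← Finset.mul_sum] at htotal
  simp only [Finset.sum_const, smul_eq_mul, mul_one] at htotal
  have h5 := Nat.mul_le_mul_left A₀.card hfew
  have h6 : 2 ^ (q + 1) * ∑ T ∈ P, (A₀.filter fun x => ∀ t, col x (T t) = χ).card =
    2 * (2 ^ q * ∑ T ∈ P, (A₀.filter fun x => ∀ t, col x (T t) = χ).card) := by ring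
  rw [h6] at htotal
  nlinarith

/-- The preceding lemma applied to several classes `B j` one after the other. -/
theorem exists_subset_large_common_neighborhoods [DecidableEq V] {ι : Type*} [DecidableEq ι]
    {A : Finset V} (J : Finset ι) (B : ι → Finset V) {q Q : ℕ} (k : ℕ) (hq : 1 ≤ q)
    (hA : A.card ≤ 2 ^ (q * Q)) (hB : ∀ j ∈ J, (B j).Nonempty) :
    ∃ χ : ι → Bool, ∃ A' ⊆ A, A.card ≤ 2 ^ ((q + 2) * J.card) * A'.card ∧
      ∀ j ∈ J, ∀ U ⊆ A', U.card ≤ k → (B j).card ≤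
        2 ^ (2 + k * Q) * ((B j).filter fun b => ∀ u ∈ U, col u b = χ j).card := by
  induction J using Finset.induction_on with
  | empty => exact ⟨fun _ => true, A, subset_rfl, by simp, by simp⟩
  | insert i J hi ih =>
    obtain ⟨χ, A₁, hA₁, hcard₁, h₁⟩ := ih fun j hj => hB j (Finset.mem_insert_of_mem hj)
    obtain ⟨c, A₂, hA₂, hcard₂, h₂⟩ := exists_subset_large_common_neighborhood (col := col) k hq
      ((Finset.card_le_card hA₁).trans hA) (hB i (Finset.mem_insert_self _ _))
    refine ⟨Function.update χ i c, A₂, hA₂.trans hA₁, ?_, ?_⟩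
    · rw [Finset.card_insert_of_notMem hi]
      calc A.card ≤ 2 ^ ((q + 2) * J.card) * A₁.card := hcard₁
        _ ≤ 2 ^ ((q + 2) * J.card) * (2 ^ (q + 2) * A₂.card) := Nat.mul_le_mul_left _ hcard₂
        _ = _ := by ring
    · intro j hj U hU hUk
      by_cases hji : j = i
      · subst hji
        simpa using h₂ U hU hUk
      · rw [Function.update_of_ne hji]
        exact h₁ j (Finset.mem_of_mem_insert_of_ne hj hji) U (hU.trans hA₂) hUk

end RandomChoice

/-! ### Ramsey's theorem for growing blocks -/

section Blocks

variable {V : Type*} {col : V → V → Bool}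

theorem exists_max_mono (col : V → V → Bool) (k : Bool) (A : Finset V) :
    ∃ C ⊆ A, MonoOn col k C ∧ ∀ S ⊆ A, MonoOn col k S → S.card ≤ C.card := by
  classical
  obtain ⟨C, hC, hmax⟩ := (A.powerset.filter fun S => MonoOn col k S).exists_max_image Finset.card
    ⟨∅, by simp [MonoOn.empty]⟩
  simp only [Finset.mem_filter, Finset.mem_powerset] at hC hmax
  exact ⟨C, hC.1, hC.2, fun S hS hm => hmax S ⟨hS, hm⟩⟩

/-- Ramsey's theorem for a sequence of rapidly growing blocks `I j` with at most `2 ^ L j` vertices, each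
vertex of `I j` having weight at least `1 / L j`: if the large subsets `cur j ⊆ I j`, `j ∈ J`, contain
no red clique of weight more than `ρ true` and no blue clique of weight more than `ρ false`, then the
number of blocks is at most exponential in `ρ true + ρ false`.

The lowest block `i` plays the role of the vertex in the usual proof. It is shrunk by dependent random
choice, and then all higher blocks are restricted to the common neighborhood of a largest red and a
largest blue clique in it. Here `d` counts the restrictions made so far, each of which costs block `j`
a factor of at most `2 ^ e j`. -/
theorem card_blocks_le_exp [DecidableEq V] (hs : ∀ u v, col u v = col v u) (I : ℕ → Finset V)
    (L q e : ℕ → ℕ) (Q m : ℕ) (hdisj : ∀ i j, i ≠ j → Disjoint (I i) (I j))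
    (hL : ∀ i, L i = q i * Q) (hq : ∀ i, 1 ≤ q i)
    (he : ∀ i j, i < j → 2 + m * L i * Q ≤ e j)
    (hloss : ∀ i, 4 * (1 + e i * m + (q i + 2) * m) ≤ L i)
    (hI : ∀ i, (I i).card ≤ 2 ^ L i) (wt : V → ℝ) (hwt : ∀ i, ∀ v ∈ I i, 1 / (L i : ℝ) ≤ wt v)
    (J : Finset ℕ) (cur : ℕ → Finset V) (d : ℕ) (ρ : Bool → ℝ) (hd : J.card + d ≤ m)
    (hcur : ∀ j ∈ J, cur j ⊆ I j) (hbig : ∀ j ∈ J, 2 ^ L j ≤ (cur j).card * 2 ^ (1 + e j * d))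
    (hρm : ρ true + ρ false ≤ m)
    (hρ : ∀ k, ∀ S ⊆ J.biUnion cur, MonoOn col k S → ∑ v ∈ S, wt v ≤ ρ k) :
    (J.card : ℝ) + 1 ≤ Real.exp (16 * (ρ true + ρ false)) := by
  induction J using Finset.strongInduction generalizing cur d ρ with
  | H J ih =>
  have hρ0 : ∀ k, 0 ≤ ρ k := fun k => by
    simpa using hρ k ∅ (Finset.empty_subset _) (MonoOn.empty k)
  rcases J.eq_empty_or_nonempty with rfl | hJ
  · simpa using add_nonneg (hρ0 true) (hρ0 false)
  set i := J.min' hJ with hi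
  have hiJ : i ∈ J := J.min'_mem hJ
  have hlt : ∀ j ∈ J.erase i, i < j := fun j hj => by
    have h1 := J.min'_le j (Finset.mem_of_mem_erase hj)
    exact lt_of_le_of_ne h1 (Finset.ne_of_mem_erase hj).symm
  have hJcard : (J.erase i).card + 1 = J.card := Finset.card_erase_add_one hiJ
  have hLpos : 0 < L i := by have := hloss i; omega
  have hLpos' : (0 : ℝ) < L i := by exact_mod_cast hLpos
  have hne : ∀ j ∈ J.erase i, (cur j).Nonempty := fun j hj => by
    have h1 := hbig j (Finset.mem_of_mem_erase hj)
    rw [← Finset.card_pos]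
    by_contra h0
    have h2 : (cur j).card = 0 := by omega
    have h3 : 0 < 2 ^ L j := by positivity
    rw [h2] at h1
    omega
  obtain ⟨χ, A, hA, hAcard, hAnbr⟩ := exists_subset_large_common_neighborhoods (col := col)
    (J.erase i) cur (Q := Q) (m * L i) (hq i)
    (by rw [← hL]; exact (Finset.card_le_card (hcur i hiJ)).trans (hI i)) hne
  have hAI : A ⊆ I i := hA.trans (hcur i hiJ)
  have hAJ : A ⊆ J.biUnion cur := hA.trans (Finset.subset_biUnion_of_mem cur hiJ)
  choose C hCA hCmono hCmax using fun k => exists_max_mono col k A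
  -- By `hloss` all the losses together are at most `2 ^ (L i / 4)`, and `2 ^ (3 / 4) > exp (1 / 2)`.
  have hAbig : Real.exp (1 / 2 * L i) ≤ A.card := by
    have h1 : 2 ^ L i ≤ A.card * 2 ^ (1 + e i * m + (q i + 2) * m) := by
      calc 2 ^ L i ≤ (cur i).card * 2 ^ (1 + e i * d) := hbig i hiJ
        _ ≤ (2 ^ ((q i + 2) * (J.erase i).card) * A.card) * 2 ^ (1 + e i * d) :=
          Nat.mul_le_mul_right _ hAcard
        _ = A.card * 2 ^ (1 + e i * d + (q i + 2) * (J.erase i).card) := by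
          rw [pow_add _ (1 + e i * d)]; ring
        _ ≤ _ := by
          refine Nat.mul_le_mul_left _ (Nat.pow_le_pow_right (by norm_num) ?_)
          gcongr <;> omega
    have h2 : (2 : ℝ) ^ L i ≤ A.card * 2 ^ (1 + e i * m + (q i + 2) * m) := by exact_mod_cast h1
    have h3 : (4 : ℝ) * ((1 + e i * m + (q i + 2) * m : ℕ) : ℝ) ≤ L i := by exact_mod_cast hloss i
    generalize 1 + e i * m + (q i + 2) * m = s at h2 h3
    have h4 : ∀ n : ℕ, (2 : ℝ) ^ n = Real.exp (n * Real.log 2) := fun n => by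
      rw [Real.exp_nat_mul, Real.exp_log two_pos]
    rw [h4, h4, ← div_le_iff₀ (Real.exp_pos _), ← Real.exp_sub] at h2
    refine (Real.exp_le_exp.2 ?_).trans h2
    have := Real.log_two_gt_d9
    nlinarith
  have hgood : Real.exp (-16 * ((C true).card / L i)) + Real.exp (-16 * ((C false).card / L i)) ≤ 1 :=
    exp_neg_add_exp_neg_le_one hLpos' _ _ fun p hp0 hp1 => by
      have hp1' : 0 < 1 - p := by linarith
      refine le_trans ?_ (card_mul_pow_le_one hs hp0 hp1 A _ _ (hCmax true) (hCmax false))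
      gcongr
      linarith
  have hCwt : ∀ k, (C k).card / (L i : ℝ) ≤ ∑ v ∈ C k, wt v := fun k => by
    have := Finset.card_nsmul_le_sum (C k) wt (1 / (L i : ℝ)) fun v hv => hwt i v (hAI (hCA k hv))
    rw [nsmul_eq_mul] at this
    calc _ = (C k).card * (1 / (L i : ℝ)) := by ring
      _ ≤ _ := this
  have hCρ : ∀ k, (C k).card / (L i : ℝ) ≤ ρ k := fun k =>
    (hCwt k).trans (hρ k _ ((hCA k).trans hAJ) (hCmono k))
  have hUcard : (C true ∪ C false).card ≤ m * L i := by
    refine (Finset.card_union_le _ _).trans ?_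
    have h1 := hCρ true
    have h2 := hCρ false
    rw [div_le_iff₀ hLpos'] at h1 h2
    have : ((C true).card : ℝ) + (C false).card ≤ m * L i := by nlinarith
    exact_mod_cast this
  have hUA : C true ∪ C false ⊆ A := Finset.union_subset (hCA true) (hCA false)
  let cur' : ℕ → Finset V := fun j => (cur j).filter fun b => ∀ u ∈ C true ∪ C false, col u b = χ j
  have hcur' : ∀ j, cur' j ⊆ cur j := fun j => Finset.filter_subset _ _
  have hbig' : ∀ j ∈ J.erase i, 2 ^ L j ≤ (cur' j).card * 2 ^ (1 + e j * (d + 1)) := by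
    intro j hj
    calc 2 ^ L j ≤ (cur j).card * 2 ^ (1 + e j * d) := hbig j (Finset.mem_of_mem_erase hj)
      _ ≤ (2 ^ (2 + m * L i * Q) * (cur' j).card) * 2 ^ (1 + e j * d) :=
        Nat.mul_le_mul_right _ (hAnbr j hj _ hUA hUcard)
      _ ≤ (2 ^ e j * (cur' j).card) * 2 ^ (1 + e j * d) := by
        gcongr
        · norm_num
        · exact he i j (hlt j hj)
      _ = _ := by ring
  have hstep : ∀ k, ((((J.erase i).filter fun j => χ j = k).card : ℝ) + 1) ≤
      Real.exp (16 * (ρ true + ρ false)) * Real.exp (-16 * ((C k).card / L i)) := by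
    intro k
    have hsub : (J.erase i).filter (fun j => χ j = k) ⊆ J.erase i := Finset.filter_subset _ _
    have hsubJ : (J.erase i).filter (fun j => χ j = k) ⊆ J := hsub.trans (Finset.erase_subset _ _)
    have hupd : Function.update ρ k (ρ k - (C k).card / L i) true +
        Function.update ρ k (ρ k - (C k).card / L i) false =
        ρ true + ρ false - (C k).card / L i := by
      cases k <;> simp [Function.update] <;> ring
    have hkpos : (0 : ℝ) ≤ (C k).card / L i := by positivity
    have h := ih _ (hsub.trans_ssubset (Finset.erase_ssubset hiJ)) cur' (d + 1)
      (Function.update ρ k (ρ k - (C k).card / L i))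
      (by have := Finset.card_le_card hsub; omega)
      (fun j hj => (hcur' j).trans (hcur j (hsubJ hj)))
      (fun j hj => hbig' j (hsub hj)) (by rw [hupd]; linarith) ?_
    · rw [hupd] at h
      rw [← Real.exp_add]
      refine h.trans_eq ?_
      congr 1; ring
    intro k' S hS hSmono
    have hSJ : S ⊆ J.biUnion cur := by
      refine hS.trans fun v hv => ?_
      obtain ⟨j, hj, hvj⟩ := Finset.mem_biUnion.1 hv
      exact Finset.mem_biUnion.2 ⟨j, hsubJ hj, hcur' j hvj⟩
    by_cases hk : k' = k
    · subst hk
      rw [Function.update_self]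
      have hdis : Disjoint (C k') S := by
        rw [Finset.disjoint_left]
        intro v hvC hvS
        obtain ⟨j, hj, hvj⟩ := Finset.mem_biUnion.1 (hS hvS)
        exact Finset.disjoint_left.1 (hdisj i j (hlt j (hsub hj)).ne) (hAI (hCA k' hvC))
          (hcur j (hsubJ hj) (hcur' j hvj))
      have h1 := hρ k' (C k' ∪ S) (Finset.union_subset ((hCA k').trans hAJ) hSJ)
        (MonoOn.union hs (hCmono k') hSmono fun u hu v hv => by
          obtain ⟨j, hj, hvj⟩ := Finset.mem_biUnion.1 (hS hv)
          rw [(Finset.mem_filter.1 hvj).2 u (by cases k' <;> simp [hu])]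
          exact (Finset.mem_filter.1 hj).2)
      rw [Finset.sum_union hdis] at h1
      have := hCwt k'
      linarith
    · rw [Function.update_of_ne hk]
      exact hρ k' S hSJ hSmono
  have hsplit : J.card + 1 = (((J.erase i).filter fun j => χ j = true).card + 1) +
      (((J.erase i).filter fun j => χ j = false).card + 1) := by
    have h1 := Finset.card_filter_add_card_filter_not (s := J.erase i) (fun j => χ j = true)
    simp only [Bool.not_eq_true] at h1
    omega
  have hsplit' := congrArg (Nat.cast (R := ℝ)) hsplit
  push_cast at hsplit'
  rw [hsplit']
  refine (add_le_add (hstep true) (hstep false)).trans ?_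
  rw [← mul_add]
  exact mul_le_of_le_one_right (Real.exp_pos _).le hgood

end Blocks

/-! ### Colorings with small monochromatic cliques -/

section ErdosColoring

theorem card_filter_forall_mem_eq_mul_two_pow {α : Type*} [Fintype α] [DecidableEq α]
    (E : Finset α) (k : Bool) :
    (Finset.univ.filter fun f : α → Bool => ∀ e ∈ E, f e = k).card * 2 ^ E.card =
      Fintype.card (α → Bool) := by
  have h1 : (Finset.univ.filter fun f : α → Bool => ∀ e ∈ E, f e = k) =
      Fintype.piFinset fun a => if a ∈ E then {k} else Finset.univ := by
    ext f
    simp only [Finset.mem_filter, Finset.mem_univ, true_and, Fintype.mem_piFinset]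
    refine forall_congr' fun a => ?_
    by_cases h : a ∈ E <;> simp [h]
  have h2 : (2 : ℕ) ^ E.card = ∏ a : α, if a ∈ E then 2 else 1 := by
    simp [Finset.prod_ite_mem]
  rw [h1, Fintype.card_piFinset, h2, ← Finset.prod_mul_distrib, Fintype.card_fun, Fintype.card_bool,
    ← Finset.card_univ, ← Finset.prod_const]
  refine Finset.prod_congr rfl fun a _ => ?_
  by_cases h : a ∈ E <;> simp [h]

/-- Erdős's lower bound for diagonal Ramsey numbers, by counting: the color of the edge `uv` is the
value of `f` at the two-element set `{u, v}`. -/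
theorem exists_coloring_forall_mono_card_le (l : ℕ) :
    ∃ g : ℕ → ℕ → Bool, (∀ u v, g u v = g v u) ∧
      ∀ k, ∀ S ⊆ Finset.range (2 ^ l), MonoOn g k S → S.card ≤ 2 * l + 2 := by
  classical
  set N := 2 ^ l with hN
  set s := 2 * l + 3 with hs
  obtain ⟨f, hf⟩ : ∃ f : Finset (Fin N) → Bool, ∀ k, ∀ S : Finset (Fin N), S.card = s →
      ¬ ∀ e ∈ S.powersetCard 2, f e = k := by
    by_contra! hcon
    have hcover : (Finset.univ : Finset (Finset (Fin N) → Bool)) ⊆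
        ((Finset.univ : Finset Bool) ×ˢ (Finset.univ : Finset (Fin N)).powersetCard s).biUnion
          fun x => Finset.univ.filter fun f => ∀ e ∈ x.2.powersetCard 2, f e = x.1 := by
      intro f _
      obtain ⟨k, S, hS, hfS⟩ := hcon f
      simp only [Finset.mem_biUnion, Finset.mem_product, Finset.mem_powersetCard, Finset.mem_filter,
        Finset.mem_univ, true_and, Finset.subset_univ]
      exact ⟨(k, S), hS, by simpa [Finset.mem_powersetCard] using hfS⟩
    have h1 := (Finset.card_le_card hcover).trans Finset.card_biUnion_le
    have h2 : ∀ x ∈ (Finset.univ : Finset Bool) ×ˢ (Finset.univ : Finset (Fin N)).powersetCard s,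
        (Finset.univ.filter fun f : Finset (Fin N) → Bool =>
          ∀ e ∈ x.2.powersetCard 2, f e = x.1).card * 2 ^ s.choose 2 =
        Fintype.card (Finset (Fin N) → Bool) := by
      intro x hx
      have hx2 : x.2.card = s := (Finset.mem_powersetCard.1 (Finset.mem_product.1 hx).2).2
      have := card_filter_forall_mem_eq_mul_two_pow (x.2.powersetCard 2) x.1
      rwa [Finset.card_powersetCard, hx2] at this
    have h3 := Nat.mul_le_mul_right (2 ^ s.choose 2) h1
    rw [Finset.sum_mul, Finset.sum_congr rfl h2, Finset.sum_const, smul_eq_mul, Finset.card_univ,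
      Finset.card_product, Finset.card_powersetCard, Finset.card_univ, Finset.card_univ,
      Fintype.card_bool, Fintype.card_fin, mul_comm] at h3
    have h4 := Nat.le_of_mul_le_mul_right h3 Fintype.card_pos
    have h5 : N.choose s ≤ 2 ^ (l * s) := by
      rw [pow_mul]; exact Nat.choose_le_pow N s
    have h6 : s.choose 2 = l * s + (2 * l + 3) := by
      rw [Nat.choose_two_right, hs, show (2 * l + 3) * (2 * l + 3 - 1) =
        2 * (l * (2 * l + 3) + (2 * l + 3)) by
          rw [show 2 * l + 3 - 1 = 2 * l + 2 by omega]; ring]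
      exact Nat.mul_div_cancel_left _ two_pos
    have h7 : 2 ^ (l * s + (2 * l + 3)) ≤ 2 ^ (l * s + 1) := by
      rw [← h6, pow_succ, mul_comm _ 2]
      exact h4.trans (Nat.mul_le_mul_left _ h5)
    have := (Nat.pow_le_pow_iff_right (by norm_num)).1 h7
    omega
  refine ⟨fun u v => if h : u < N ∧ v < N then f {⟨u, h.1⟩, ⟨v, h.2⟩} else true, ?_, ?_⟩
  · intro u v
    by_cases h : u < N ∧ v < N
    · simp only [h, and_self, dite_true, Finset.pair_comm]
    · have h' : ¬ (v < N ∧ u < N) := fun h' => h h'.symm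
      simp only [h, h', dite_false]
  · intro k S hS hmono
    by_contra! hlt
    obtain ⟨S', hS', hcard⟩ := Finset.exists_subset_card_eq (show s ≤ S.card by omega)
    have hlt' : ∀ u ∈ S', u < N := fun u hu => Finset.mem_range.1 (hS (hS' hu))
    refine hf k (S'.attachFin hlt') (by rw [Finset.card_attachFin, hcard]) fun e he => ?_
    obtain ⟨heS, he2⟩ := Finset.mem_powersetCard.1 he
    obtain ⟨x, y, hxy, rfl⟩ := Finset.card_eq_two.1 he2
    have hx : (x : ℕ) ∈ S' := (Finset.mem_attachFin hlt').1 (heS (by simp))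
    have hy : (y : ℕ) ∈ S' := (Finset.mem_attachFin hlt').1 (heS (by simp))
    have := hmono x (hS' hx) y (hS' hy) (fun h => hxy (Fin.ext h))
    simpa using this

end ErdosColoring

/-! ### The block coloring -/

section Weights

theorem natLog_le_logb_two (s : ℕ) : (Nat.log 2 s : ℝ) ≤ Real.logb 2 s := by
  exact_mod_cast Real.natLog_le_logb s 2

/-- The index of the block `2 ^ 2 ^ i ≤ s < 2 ^ 2 ^ (i + 1)` containing `s ≥ 2`. -/
def blockIndex (s : ℕ) : ℕ := Nat.log 2 (Nat.log 2 s)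

theorem lt_two_pow_two_pow_blockIndex (s : ℕ) : s < 2 ^ 2 ^ (blockIndex s + 1) :=
  (Nat.lt_pow_succ_log_self (by norm_num) s).trans_le
    (Nat.pow_le_pow_right (by norm_num) (Nat.lt_pow_succ_log_self (by norm_num) (Nat.log 2 s)))

theorem blockIndex_mono : Monotone blockIndex := fun _ _ h => Nat.log_mono_right (Nat.log_mono_right h)

theorem two_pow_blockIndex_le_logb {s : ℕ} (hs : 2 ≤ s) :
    (2 : ℝ) ^ blockIndex s ≤ Real.logb 2 s := by
  have h1 : Nat.log 2 s ≠ 0 := (Nat.log_pos (by norm_num) hs).ne'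
  have h2 : 2 ^ blockIndex s ≤ Nat.log 2 s := Nat.pow_log_le_self 2 h1
  exact le_trans (by exact_mod_cast h2) (natLog_le_logb_two s)

/-- The block coloring: a coloring without large monochromatic cliques inside each block, and one such
coloring of the block indices for the edges between blocks. A monochromatic clique then meets few
blocks, and has bounded weight in each of them. -/
theorem exists_coloring_weight_le (n : ℕ) : ∃ col : ℕ → ℕ → Bool, (∀ u v, col u v = col v u) ∧
    ∀ k, ∀ S ⊆ Finset.Icc 2 n, MonoOn col k S →
      weight S ≤ 12 * ((Nat.log 2 (blockIndex n) : ℝ) + 2) := by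
  choose g hgs hg using exists_coloring_forall_mono_card_le
  set T := Nat.log 2 (blockIndex n) + 1 with hT
  refine ⟨fun u v => if blockIndex u = blockIndex v then g (2 ^ (blockIndex u + 1)) u v
    else g T (blockIndex u) (blockIndex v), ?_, ?_⟩
  · intro u v
    by_cases h : blockIndex u = blockIndex v
    · simp only [h, if_true]; exact hgs _ _ _
    · simp only [h, Ne.symm h, if_false]; exact hgs _ _ _
  · intro k S hS hmono
    have hcard : (S.image blockIndex).card ≤ 2 * T + 2 := by
      refine hg T k _ ?_ ?_
      · intro i hi
        obtain ⟨s, hs, rfl⟩ := Finset.mem_image.1 hi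
        exact Finset.mem_range.2 ((blockIndex_mono (Finset.mem_Icc.1 (hS hs)).2).trans_lt
          (Nat.lt_pow_succ_log_self (by norm_num) _))
      · intro i hi j hj hij
        obtain ⟨s, hs, rfl⟩ := Finset.mem_image.1 hi
        obtain ⟨t, ht, rfl⟩ := Finset.mem_image.1 hj
        have := hmono s hs t ht (fun h => hij (by rw [h]))
        simpa only [hij, if_false] using this
    have hfiber : ∀ i ∈ S.image blockIndex,
        ∑ s ∈ S.filter (fun s => blockIndex s = i), 1 / Real.logb 2 (s : ℝ) ≤ 6 := by
      intro i _
      have h1 : (S.filter fun s => blockIndex s = i).card ≤ 2 * 2 ^ (i + 1) + 2 := by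
        refine hg (2 ^ (i + 1)) k _ ?_ ?_
        · intro s hs
          obtain ⟨-, rfl⟩ := Finset.mem_filter.1 hs
          exact Finset.mem_range.2 (lt_two_pow_two_pow_blockIndex s)
        · intro u hu v hv huv
          obtain ⟨huS, rfl⟩ := Finset.mem_filter.1 hu
          obtain ⟨hvS, hvu⟩ := Finset.mem_filter.1 hv
          have := hmono u huS v hvS huv
          simpa only [hvu, if_true] using this
      have h2 : ∀ s ∈ S.filter (fun s => blockIndex s = i),
          1 / Real.logb 2 (s : ℝ) ≤ 1 / (2 : ℝ) ^ i := by
        intro s hs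
        obtain ⟨hsS, rfl⟩ := Finset.mem_filter.1 hs
        exact one_div_le_one_div_of_le (by positivity)
          (two_pow_blockIndex_le_logb (Finset.mem_Icc.1 (hS hsS)).1)
      refine (Finset.sum_le_card_nsmul _ _ _ h2).trans ?_
      rw [nsmul_eq_mul, mul_one_div, div_le_iff₀ (by positivity)]
      have h3 : ((S.filter fun s => blockIndex s = i).card : ℝ) ≤ 2 * 2 ^ (i + 1) + 2 := by
        exact_mod_cast h1
      have h4 : (1 : ℝ) ≤ 2 ^ i := one_le_pow₀ one_le_two
      rw [pow_succ] at h3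
      linarith
    have hsum : weight S = ∑ i ∈ S.image blockIndex,
        ∑ s ∈ S.filter (fun s => blockIndex s = i), 1 / Real.logb 2 (s : ℝ) :=
      (Finset.sum_fiberwise_of_maps_to (fun s hs => Finset.mem_image_of_mem _ hs) _).symm
    rw [hsum]
    refine (Finset.sum_le_card_nsmul _ _ _ hfiber).trans ?_
    rw [nsmul_eq_mul]
    have : ((S.image blockIndex).card : ℝ) ≤ 2 * (Nat.log 2 (blockIndex n) + 1) + 2 := by
      exact_mod_cast hcard
    linarith

end Weights

/-! ### Choice of the blocks -/

section LowerBound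

theorem four_mul_le_two_pow {m : ℕ} (hm : 10 ≤ m) : 4 * (m ^ 2 + 5 * m + 1) ≤ 2 ^ m := by
  induction m, hm using Nat.le_induction with
  | base => norm_num
  | succ k hk ih => rw [pow_succ 2]; nlinarith

/-- Lower bound for the blocks `[2 ^ (L j - 1), 2 ^ L j)`, `j < m`, with `L j = 2 ^ (2 m (j + 1))`. -/
theorem exists_mono_lt_weight {n m : ℕ} (hm : 10 ≤ m) (hmn : 2 ^ 2 ^ (2 * m * m) ≤ n)
    (col : ℕ → ℕ → Bool) (hs : ∀ u v, col u v = col v u) {w : ℝ}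
    (hw : 64 * w ≤ Real.logb 2 (m + 1)) :
    ∃ k, ∃ S ⊆ Finset.Icc 2 n, MonoOn col k S ∧ w < weight S := by
  by_contra! hcon
  let L : ℕ → ℕ := fun i => 2 ^ (2 * m * (i + 1))
  let I : ℕ → Finset ℕ := fun i => Finset.Ico (2 ^ (L i - 1)) (2 ^ L i)
  have hL2 : ∀ i, 2 ≤ L i := fun i => by
    calc 2 = 2 ^ 1 := rfl
      _ ≤ _ := Nat.pow_le_pow_right (by norm_num) (by nlinarith)
  have hLmono : ∀ i j, i < j → L i ≤ L j - 1 := fun i j hij =>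
    Nat.le_sub_one_of_lt (Nat.pow_lt_pow_right (by norm_num) (by nlinarith))
  have hdisj' : ∀ i j, i < j → Disjoint (I i) (I j) := fun i j hij => by
    rw [Finset.disjoint_left]
    intro v hvi hvj
    have h1 := (Finset.mem_Ico.1 hvi).2
    have h2 := (Finset.mem_Ico.1 hvj).1
    have h3 := Nat.pow_le_pow_right two_pos (hLmono i j hij)
    omega
  have hI : ∀ i, (I i).card * 2 = 2 ^ L i := fun i => by
    have h1 : 2 ^ L i = 2 ^ (L i - 1) * 2 := by
      rw [← pow_succ]; congr 1; have := hL2 i; omega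
    simp only [I, Nat.card_Ico]
    omega
  have hI2 : ∀ i, ∀ v ∈ I i, 2 ≤ v := fun i v hv => by
    have h1 := (Finset.mem_Ico.1 hv).1
    have h2 : 2 ^ 1 ≤ 2 ^ (L i - 1) := Nat.pow_le_pow_right (by norm_num) (by have := hL2 i; omega)
    omega
  have hw2 : 2 * w ≤ Real.log (m + 1) / 16 := by
    rw [Real.logb, le_div_iff₀ (Real.log_pos one_lt_two)] at hw
    have := Real.log_two_gt_d9
    by_cases hw0 : 0 ≤ w
    · nlinarith
    · have : 0 ≤ Real.log ((m : ℝ) + 1) := Real.log_nonneg (by linarith [Nat.cast_nonneg (α := ℝ) m])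
      linarith
  have hm1 : (0 : ℝ) < m + 1 := by positivity
  have hlogm := Real.log_le_sub_one_of_pos hm1
  have hw3 : 32 * w < Real.log (m + 1) := by
    rw [Real.logb, le_div_iff₀ (Real.log_pos one_lt_two)] at hw
    have := Real.log_two_gt_d9
    have hpos : 0 < Real.log ((m : ℝ) + 1) := Real.log_pos (by
      have : (10 : ℝ) ≤ m := by exact_mod_cast hm
      linarith)
    by_cases hw0 : 0 ≤ w
    · nlinarith
    · linarith
  have hmain := card_blocks_le_exp hs I L (fun i => 2 ^ (m * (2 * i + 1)))
    (fun j => 2 + m * 2 ^ (2 * m * j + m)) (2 ^ m) m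
    (fun i j hij => by
      rcases lt_or_gt_of_ne hij with h | h
      · exact hdisj' i j h
      · exact (hdisj' j i h).symm)
    (fun i => by simp only [L]; rw [← pow_add]; congr 1; ring)
    (fun i => Nat.one_le_two_pow)
    (fun i j hij => by
      simp only [L]
      rw [mul_assoc, ← pow_add]
      gcongr
      · norm_num
      · omega)
    (fun i => by
      simp only [L]
      have h1 : m * (2 * i + 1) = 2 * m * i + m := by ring
      have h2 : 2 * m * (i + 1) = (2 * m * i + m) + m := by ring
      rw [h1, h2, pow_add _ (2 * m * i + m) m]
      have hX : 1 ≤ 2 ^ (2 * m * i + m) := Nat.one_le_two_pow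
      generalize 2 ^ (2 * m * i + m) = X at hX ⊢
      calc 4 * (1 + (2 + m * X) * m + (X + 2) * m) = 4 * ((1 + 4 * m) * 1 + (m ^ 2 + m) * X) := by
            ring
        _ ≤ 4 * ((1 + 4 * m) * X + (m ^ 2 + m) * X) := by gcongr
        _ = X * (4 * (m ^ 2 + 5 * m + 1)) := by ring
        _ ≤ _ := Nat.mul_le_mul_left _ (four_mul_le_two_pow hm))
    (fun i => by have := hI i; omega)
    (fun s => 1 / Real.logb 2 s)
    (fun i v hv => by
      have h2 : (2 : ℝ) ≤ v := by exact_mod_cast hI2 i v hv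
      refine one_div_le_one_div_of_le (Real.logb_pos one_lt_two (by linarith)) ?_
      have h3 : (v : ℝ) ≤ 2 ^ L i := by exact_mod_cast (Finset.mem_Ico.1 hv).2.le
      calc Real.logb 2 v ≤ Real.logb 2 (2 ^ L i) := Real.logb_le_logb_of_le one_lt_two (by linarith) h3
        _ = L i := by rw [Real.logb_pow, Real.logb_self_eq_one one_lt_two, mul_one])
    (Finset.range m) I 0 (fun _ => w) (by simp) (fun _ _ => subset_rfl)
    (fun j _ => by rw [mul_zero, add_zero, pow_one]; exact (hI j).ge)
    (by linarith)
    (fun k S hS hmono => by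
      refine hcon k S (fun v hv => ?_) hmono
      obtain ⟨j, hj, hvj⟩ := Finset.mem_biUnion.1 (hS hv)
      refine Finset.mem_Icc.2 ⟨hI2 j v hvj, (Finset.mem_Ico.1 hvj).2.le.trans (le_trans ?_ hmn)⟩
      have hjm : j + 1 ≤ m := Finset.mem_range.1 hj
      exact Nat.pow_le_pow_right (by norm_num)
        (Nat.pow_le_pow_right (by norm_num) (Nat.mul_le_mul_left _ hjm)))
  rw [Finset.card_range, ← Real.log_le_iff_le_exp hm1] at hmain
  linarith

theorem logb_two_natCast_le {n t : ℕ} (hn : 0 < n) (h : Nat.log 2 n ≤ t) : Real.logb 2 n ≤ t + 1 := by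
  have h1 : n ≤ 2 ^ (t + 1) := (Nat.lt_pow_succ_log_self (by norm_num) n).le.trans
    (Nat.pow_le_pow_right (by norm_num) (by omega))
  calc Real.logb 2 n ≤ Real.logb 2 (2 ^ (t + 1) : ℝ) :=
        Real.logb_le_logb_of_le one_lt_two (by exact_mod_cast hn) (by exact_mod_cast h1)
    _ = t + 1 := by
        rw [Real.logb_pow, Real.logb_self_eq_one one_lt_two, mul_one]; push_cast; ring

theorem logb_logb_le_blockIndex_add_one {n : ℕ} (hn : 2 ≤ n) :
    Real.logb 2 (Real.logb 2 n) ≤ blockIndex n + 1 := by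
  have h1 := logb_two_natCast_le (by omega) (le_refl (Nat.log 2 n))
  have h2 : 0 < Real.logb 2 n := Real.logb_pos one_lt_two (by exact_mod_cast hn)
  have h3 : Nat.log 2 n + 1 ≤ 2 ^ (blockIndex n + 1) := Nat.lt_pow_succ_log_self (by norm_num) _
  have h4 : Real.logb 2 n ≤ 2 ^ (blockIndex n + 1) := h1.trans (by exact_mod_cast h3)
  calc _ ≤ Real.logb 2 ((2 : ℝ) ^ (blockIndex n + 1)) := Real.logb_le_logb_of_le one_lt_two h2 h4
    _ = _ := by rw [Real.logb_pow, Real.logb_self_eq_one one_lt_two, mul_one]; push_cast; ring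

theorem blockIndex_le_logb_logb {n : ℕ} (hn : 2 ≤ n) :
    (blockIndex n : ℝ) ≤ Real.logb 2 (Real.logb 2 n) := by
  have h := two_pow_blockIndex_le_logb hn
  calc (blockIndex n : ℝ) = Real.logb 2 ((2 : ℝ) ^ blockIndex n) := by
        rw [Real.logb_pow, Real.logb_self_eq_one one_lt_two, mul_one]
    _ ≤ _ := Real.logb_le_logb_of_le one_lt_two (by positivity) h

theorem tendsto_natLog_two : Tendsto (Nat.log 2) atTop atTop :=
  tendsto_atTop.2 fun b => (eventually_ge_atTop (2 ^ b)).mono fun n hn => by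
    rw [← Nat.log_pow (b := 2) (by norm_num) b]
    exact Nat.log_mono_right hn

theorem tendsto_blockIndex : Tendsto blockIndex atTop atTop :=
  tendsto_natLog_two.comp tendsto_natLog_two

/-- With `t = blockIndex n` close to `log log n`, about `√(t / 2)` blocks fit below `n`, and the logarithm
of their number is at least about `(log t) / 4`. -/
theorem exists_mono_logb_logb_logb_lt_weight {n : ℕ} (hn : 200 ≤ blockIndex n)
    (col : ℕ → ℕ → Bool) (hs : ∀ u v, col u v = col v u) :
    ∃ k, ∃ S ⊆ Finset.Icc 2 n, MonoOn col k S ∧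
      (2 : ℝ) ^ (-8 : ℤ) * Real.logb 2 (Real.logb 2 (Real.logb 2 (n : ℝ))) < weight S := by
  have hn2 : 2 ≤ n := by
    by_contra h
    have : n ≤ 1 := by omega
    have h0 : Nat.log 2 n = 0 := Nat.log_of_lt (by omega)
    simp [blockIndex, h0] at hn
  set t := blockIndex n with ht
  set m := Nat.sqrt (t / 2) with hm
  have hm10 : 10 ≤ m := Nat.le_sqrt.2 (by omega)
  have hmt : 2 * m * m ≤ t := by
    have : m * m ≤ t / 2 := Nat.sqrt_le _
    have : 2 * m * m = 2 * (m * m) := by ring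
    omega
  have htm : t + 1 ≤ 2 * ((m + 1) * (m + 1)) := by
    have : t / 2 < (m + 1) * (m + 1) := Nat.lt_succ_sqrt _
    omega
  refine exists_mono_lt_weight hm10 ?_ col hs ?_
  · have h1 : Nat.log 2 n ≠ 0 := (Nat.log_pos (by norm_num) hn2).ne'
    calc 2 ^ 2 ^ (2 * m * m) ≤ 2 ^ 2 ^ t :=
          Nat.pow_le_pow_right (by norm_num) (Nat.pow_le_pow_right (by norm_num) hmt)
      _ ≤ 2 ^ Nat.log 2 n := Nat.pow_le_pow_right (by norm_num) (Nat.pow_log_le_self 2 h1)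
      _ ≤ n := Nat.pow_log_le_self 2 (by omega)
  · have h1 := blockIndex_le_logb_logb hn2
    have h2 : (200 : ℝ) ≤ t := by exact_mod_cast hn
    have h3 : t + 1 ≤ (m + 1) ^ 4 := htm.trans (by
      have : 2 ≤ (m + 1) * (m + 1) := by nlinarith
      calc 2 * ((m + 1) * (m + 1)) ≤ ((m + 1) * (m + 1)) * ((m + 1) * (m + 1)) := by gcongr
        _ = _ := by ring)
    have h4 : Real.logb 2 (Real.logb 2 n) ≤ ((m : ℝ) + 1) ^ 4 :=
      (logb_logb_le_blockIndex_add_one hn2).trans (by exact_mod_cast h3)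
    have h5 : Real.logb 2 (Real.logb 2 (Real.logb 2 n)) ≤ 4 * Real.logb 2 (m + 1) := by
      refine (Real.logb_le_logb_of_le one_lt_two (by linarith) h4).trans_eq ?_
      rw [Real.logb_pow]; norm_num
    norm_num
    linarith

end LowerBound

/-! ### Edge colorings and symmetric functions -/

section EdgeColorings

theorem MonoOn.isMonoClique {n : ℕ} {c : EdgeColoring n} {col : ℕ → ℕ → Bool}
    (hcol : ∀ u v : Finset.Icc 2 n, ∀ h : u ≠ v, col u v = c.get u v h) {k : Bool} {S : Finset ℕ}
    (hS : S ⊆ Finset.Icc 2 n) (h : MonoOn col k S) : IsMonoClique c S := by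
  refine ⟨hS, k, fun u hu v hv huv => ?_⟩
  rw [SimpleGraph.TopEdgeLabeling.labelGraph_adj]
  exact ⟨huv, by rw [← hcol]; exact h u hu v hv fun h => huv (Subtype.ext h)⟩

theorem IsMonoClique.exists_monoOn {n : ℕ} {c : EdgeColoring n} {col : ℕ → ℕ → Bool}
    (hcol : ∀ u v : Finset.Icc 2 n, ∀ h : u ≠ v, col u v = c.get u v h) {S : Finset ℕ}
    (h : IsMonoClique c S) : ∃ k, MonoOn col k S := by
  obtain ⟨hS, k, hk⟩ := h
  refine ⟨k, fun u hu v hv huv => ?_⟩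
  have hne : (⟨u, hS hu⟩ : Finset.Icc 2 n) ≠ ⟨v, hS hv⟩ := fun h => huv (congrArg Subtype.val h)
  obtain ⟨h1, h2⟩ := (SimpleGraph.TopEdgeLabeling.labelGraph_adj _ _).1 (hk hu hv hne)
  rw [← h2]
  exact hcol ⟨u, hS hu⟩ ⟨v, hS hv⟩ hne

/-- Edge colorings are handled through symmetric functions on all of `ℕ`; the values outside
`{2, …, n}` and on the diagonal are irrelevant. -/
theorem EdgeColoring.exists_symmetric_extension {n : ℕ} (c : EdgeColoring n) :
    ∃ col : ℕ → ℕ → Bool, (∀ u v, col u v = col v u) ∧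
      ∀ u v : Finset.Icc 2 n, ∀ h : u ≠ v, col u v = c.get u v h := by
  classical
  refine ⟨fun u v => if h : ∃ (hu : u ∈ Finset.Icc 2 n) (hv : v ∈ Finset.Icc 2 n), u ≠ v then
    c.get ⟨u, h.1⟩ ⟨v, h.2.1⟩ (fun h' => h.2.2 (congrArg Subtype.val h')) else true, ?_, ?_⟩
  · intro u v
    by_cases h : ∃ (hu : u ∈ Finset.Icc 2 n) (hv : v ∈ Finset.Icc 2 n), u ≠ v
    · have h' : ∃ (hv : v ∈ Finset.Icc 2 n) (hu : u ∈ Finset.Icc 2 n), v ≠ u :=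
        ⟨h.2.1, h.1, h.2.2.symm⟩
      simp only [dif_pos h, dif_pos h']
      exact SimpleGraph.EdgeLabeling.get_comm _ _ _
    · have h' : ¬ ∃ (hv : v ∈ Finset.Icc 2 n) (hu : u ∈ Finset.Icc 2 n), v ≠ u :=
        fun h' => h ⟨h'.2.1, h'.1, h'.2.2.symm⟩
      simp only [dif_neg h, dif_neg h']
  · intro u v huv
    have h : ∃ (hu : (u : ℕ) ∈ Finset.Icc 2 n) (hv : (v : ℕ) ∈ Finset.Icc 2 n), (u : ℕ) ≠ v :=
      ⟨u.2, v.2, fun h => huv (Subtype.ext h)⟩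
    simp only [dif_pos h]

theorem minMaxWeight_le (n : ℕ) :
    minMaxWeight n ≤ 12 * ((Nat.log 2 (blockIndex n) : ℝ) + 2) := by
  obtain ⟨col, hs, hcol⟩ := exists_coloring_weight_le n
  let c : EdgeColoring n := SimpleGraph.EdgeLabeling.mk (fun u v _ => col u v) fun u v _ => hs v u
  refine ((minMaxWeight_isLeast n).2 ⟨c, rfl⟩).trans ?_
  obtain ⟨S, hS, hw⟩ := (maxWeight_isGreatest c).1
  obtain ⟨k, hk⟩ := hS.exists_monoOn (col := col) fun u v h => rfl
  rw [← hw]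
  exact hcol k S hS.1 hk

end EdgeColorings

/-! ### The order of magnitude of `f(n)` -/

theorem theorem1 :
    (∀ᶠ n : ℕ in atTop, ∀ c : EdgeColoring n, ∃ S : Finset ℕ, IsMonoClique c S ∧
      ∑ s ∈ S, 1 / Real.logb 2 (s : ℝ) ≥
        (2 : ℝ) ^ (-8 : ℤ) * Real.logb 2 (Real.logb 2 (Real.logb 2 (n : ℝ)))) ∧
    minMaxWeight =Θ[atTop] fun n : ℕ => Real.logb 2 (Real.logb 2 (Real.logb 2 (n : ℝ))) := by
  have hlower : ∀ᶠ n : ℕ in atTop, ∀ c : EdgeColoring n, ∃ S : Finset ℕ, IsMonoClique c S ∧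
      ∑ s ∈ S, 1 / Real.logb 2 (s : ℝ) ≥
        (2 : ℝ) ^ (-8 : ℤ) * Real.logb 2 (Real.logb 2 (Real.logb 2 (n : ℝ))) := by
    filter_upwards [tendsto_blockIndex.eventually_ge_atTop 200] with n hn c
    obtain ⟨col, hs, hcol⟩ := c.exists_symmetric_extension
    obtain ⟨k, S, hS, hmono, hw⟩ := exists_mono_logb_logb_logb_lt_weight hn col hs
    exact ⟨S, hmono.isMonoClique hcol hS, hw.le⟩
  have hlower' : ∀ᶠ n : ℕ in atTop,
      (2 : ℝ) ^ (-8 : ℤ) * Real.logb 2 (Real.logb 2 (Real.logb 2 (n : ℝ))) ≤ minMaxWeight n := by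
    filter_upwards [hlower] with n hn
    obtain ⟨c, hc⟩ := (minMaxWeight_isLeast n).1
    obtain ⟨S, hS, hw⟩ := hn c
    rw [← hc]
    exact le_trans hw ((maxWeight_isGreatest c).2 ⟨S, hS, rfl⟩)
  have hlog : ∀ᶠ n : ℕ in atTop, 1 ≤ (Nat.log 2 (blockIndex n) : ℝ) ∧ (Nat.log 2 (blockIndex n) : ℝ)
      ≤ Real.logb 2 (Real.logb 2 (Real.logb 2 (n : ℝ))) := by
    filter_upwards [(tendsto_natLog_two.comp tendsto_blockIndex).eventually_ge_atTop 1,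
      tendsto_blockIndex.eventually_ge_atTop 1, eventually_ge_atTop 2] with n hn hn1 hn2
    refine ⟨by exact_mod_cast hn, (natLog_le_logb_two _).trans ?_⟩
    exact Real.logb_le_logb_of_le one_lt_two (by exact_mod_cast hn1) (blockIndex_le_logb_logb hn2)
  refine ⟨hlower, IsBigO.of_bound 36 ?_, IsBigO.of_bound (2 ^ 8) ?_⟩
  · filter_upwards [hlower', hlog] with n h1 h2
    have h3 := minMaxWeight_le n
    norm_num at h1
    rw [Real.norm_of_nonneg (by linarith), Real.norm_of_nonneg (by linarith)]
    linarith
  · filter_upwards [hlower', hlog] with n h1 h2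
    norm_num at h1
    rw [Real.norm_of_nonneg (by linarith), Real.norm_of_nonneg (by linarith)]
    linarith
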